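/- Let $i,n$ be integers with $1\le i<n$ and put $j=n-i$. For $k\ge 1$ let $D_k$ be the set of sequences $((a_l,b_l))_{1\le l\le k}$ of pairs of positive integers such that $$\sum_{l=1}^k a_l=i,\qquad \sum_{l=1}^k b_l=n,\qquad 1>\frac{a_1}{b_1}>\cdots>\frac{a_k}{b_k}>0 .$$ Then, as an identity of Laurent polynomials with integer coefficients in $q^{1/2}$, where $q$ is an indeterminate (and hence also for every real number $q>0$, with real powers), $$\sum_{k\ge 1}\ \sum_{((a_l,b_l))_{l\le k}\in D_k}(q-1)^{k-1}\,q^{\,1-k+\frac12\left(\sum_{1\le l_1<l_2\le k}(a_{l_1}b_{l_2}-a_{l_2}b_{l_1})+\sum_{1\le l\le k}\gcd(a_l,b_l)\right)}=q^{\frac{ij-n}{2}+1}.$$ Only finitely many $D_k$ are non-empty and each is finite, so the sum is finite. -/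

import Mathlib

noncomputable section

namespace SlopeIdentity

/-- The set `D_k`: sequences of `k` pairs `(a_l, b_l)` of positive integers with `∑ a_l = i`,
`∑ b_l = n` and `1 > a_1 / b_1 > ⋯ > a_k / b_k > 0`. The slopes are taken in `ℚ`. -/
def D (i n k : ℕ) : Set (Fin k → ℕ × ℕ) :=
  {s | (∀ l, 0 < (s l).1 ∧ 0 < (s l).2) ∧
    ∑ l, (s l).1 = i ∧ ∑ l, (s l).2 = n ∧
    StrictAnti (fun l => ((s l).1 : ℚ) / ((s l).2 : ℚ)) ∧
    ∀ l, 0 < ((s l).1 : ℚ) / ((s l).2 : ℚ) ∧ ((s l).1 : ℚ) / ((s l).2 : ℚ) < 1}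

/-- The index set of the sum: all pairs of a length `k ≥ 1` and an element of `D_k`. -/
def indexSet (i n : ℕ) : Set (Σ k : ℕ, Fin k → ℕ × ℕ) :=
  {s | 1 ≤ s.1 ∧ s.2 ∈ D i n s.1}

theorem indexSet_finite (i n : ℕ) : (indexSet i n).Finite := by
  refine Set.Finite.subset (Finset.finite_toSet ((Finset.range (i + 1)).sigma fun k =>
    Fintype.piFinset fun _ : Fin k => Finset.range (i + 1) ×ˢ Finset.range (n + 1))) ?_
  rintro ⟨k, s⟩ ⟨-, hpos, ha, hb, -⟩
  dsimp only at hpos ha hb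
  have hk : k ≤ i := by
    calc k = ∑ _l : Fin k, 1 := by simp
      _ ≤ ∑ l, (s l).1 := Finset.sum_le_sum fun l _ => (hpos l).1
      _ = i := ha
  have h1 : ∀ l, (s l).1 ≤ i := fun l =>
    ha ▸ Finset.single_le_sum (f := fun l => (s l).1) (fun _ _ => Nat.zero_le _)
      (Finset.mem_univ l)
  have h2 : ∀ l, (s l).2 ≤ n := fun l =>
    hb ▸ Finset.single_le_sum (f := fun l => (s l).2) (fun _ _ => Nat.zero_le _)
      (Finset.mem_univ l)
  simp only [Finset.coe_sigma, Set.mem_sigma_iff, Finset.mem_coe, Finset.mem_range,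
    Fintype.mem_piFinset, Finset.mem_product]
  exact ⟨by omega, fun l => ⟨Nat.lt_succ_of_le (h1 l), Nat.lt_succ_of_le (h2 l)⟩⟩

/-- The exponent
`1 - k + (∑_{l₁ < l₂} (a_{l₁} b_{l₂} - a_{l₂} b_{l₁}) + ∑_l gcd (a_l, b_l)) / 2` as a rational
number. -/
def exponent {k : ℕ} (s : Fin k → ℕ × ℕ) : ℚ :=
  1 - (k : ℚ) +
    ((∑ l₁ : Fin k, ∑ l₂ ∈ Finset.Ioi l₁,
        (((s l₁).1 : ℚ) * ((s l₂).2 : ℚ) - ((s l₂).1 : ℚ) * ((s l₁).2 : ℚ))) +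
      ∑ l : Fin k, (Nat.gcd (s l).1 (s l).2 : ℚ)) / 2

/-- The formal power `q ^ r` of an indeterminate `q`, for a rational exponent `r`, as an element of
the ring `ℤ[q ^ r : r ∈ ℚ]`, the group ring of `(ℚ, +)`: the `q ^ r` form a `ℤ`-basis, and
`q ^ r * q ^ r' = q ^ (r + r')`. This ring contains the ring of Laurent polynomials in
`q ^ (1 / 2)`. -/
def qPow (r : ℚ) : AddMonoidAlgebra ℤ ℚ := AddMonoidAlgebra.single r 1

end SlopeIdentity

end

namespace SlopeIdentity

/-! ### Cross products and concave paths -/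

/-- The cross product of two vectors `(a, b)`; for vectors with positive first coordinate it is
positive when the slope `a / b` of the first one is the larger one. -/
def cr (p q : ℤ × ℤ) : ℤ := p.1 * q.2 - q.1 * p.2

/-- Transitivity of slope comparison comes from the three-term relation between the minors of three
vectors, with positive first coordinates as coefficients. -/
theorem cr_pos_trans {p q r : ℤ × ℤ} (hp : 0 < p.1) (hq : 0 < q.1) (hr : 0 < r.1)
    (h1 : 0 < cr p q) (h2 : 0 ≤ cr q r) : 0 < cr p r := by
  have h : q.1 * cr p r = r.1 * cr p q + p.1 * cr q r := by simp only [cr]; ring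
  exact pos_of_mul_pos_right (h ▸ add_pos_of_pos_of_nonneg (mul_pos hr h1)
    (mul_nonneg hp.le h2)) hq.le

theorem cr_pos_trans' {p q r : ℤ × ℤ} (hp : 0 < p.1) (hq : 0 < q.1) (hr : 0 < r.1)
    (h1 : 0 ≤ cr p q) (h2 : 0 < cr q r) : 0 < cr p r := by
  have h : q.1 * cr p r = r.1 * cr p q + p.1 * cr q r := by simp only [cr]; ring
  exact pos_of_mul_pos_right (h ▸ add_pos_of_nonneg_of_pos (mul_nonneg hr.le h1)
    (mul_pos hp h2)) hq.le

/-- If `w` lies above the chord from `v` to `e` and `p` above the chord from `w` to `e`, then `p`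
lies above the chord from `v` to `e`. -/
theorem cr_chord_trans {v w p e : ℤ × ℤ} (hw : w.1 < e.1) (hv : v.1 < e.1) (hp : p.1 < e.1)
    (h1 : 0 < cr (w - v) (e - v)) (h2 : 0 < cr (p - w) (e - w)) : 0 < cr (p - v) (e - v) := by
  have e1 : cr (w - v) (e - v) = cr (e - v) (e - w) := by simp [cr]; ring
  have e2 : cr (p - w) (e - w) = cr (e - w) (e - p) := by simp [cr]; ring
  have e3 : cr (p - v) (e - v) = cr (e - v) (e - p) := by simp [cr]; ring
  rw [e1] at h1
  rw [e2] at h2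
  rw [e3]
  exact cr_pos_trans (by simpa using hv) (by simpa using hw) (by simpa using hp) h1 h2.le

/-- `IsPath e M v L`: the list of steps `L` describes a strictly concave path from `v` to `e` all of
whose inner vertices belong to `M`. -/
inductive IsPath (e : ℤ × ℤ) (M : Finset (ℤ × ℤ)) : ℤ × ℤ → List (ℤ × ℤ) → Prop
  | last (v s : ℤ × ℤ) (hs : 0 < s.1) (he : v + s = e) : IsPath e M v [s]
  | cons (v s s' : ℤ × ℤ) (L : List (ℤ × ℤ)) (hs : 0 < s.1) (hM : v + s ∈ M) (hc : 0 < cr s s')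
      (h : IsPath e M (v + s) (s' :: L)) : IsPath e M v (s :: s' :: L)

/-- The point `p` lies strictly above the path with start `v` and steps `L`. -/
def Above : ℤ × ℤ → List (ℤ × ℤ) → ℤ × ℤ → Prop
  | _, [], _ => False
  | v, s :: L, p => if p.1 ≤ v.1 + s.1 then 0 < cr (p - v) s else Above (v + s) L p

namespace IsPath

variable {e v s : ℤ × ℤ} {M N : Finset (ℤ × ℤ)} {L : List (ℤ × ℤ)}

theorem ne_nil (h : IsPath e M v L) : L ≠ [] := by
  cases h <;> simp

theorem start_lt (h : IsPath e M v L) : v.1 < e.1 := by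
  induction h with
  | last v s hs he => rw [← he]; simpa using hs
  | cons v s s' L hs hM hc h ih => simp at ih; omega

theorem step_pos (h : IsPath e M v (s :: L)) : 0 < s.1 := by
  cases h <;> assumption

theorem mono (h : IsPath e M v L) (hMN : M ⊆ N) : IsPath e N v L := by
  induction h with
  | last v s hs he => exact .last v s hs he
  | cons v s s' L hs hM hc h ih => exact .cons v s s' L hs (hMN hM) hc ih

theorem cr_head_nonneg (h : IsPath e M v (s :: L)) : 0 ≤ cr s (e - v) := by
  generalize hL : s :: L = L' at h
  induction h generalizing s L with
  | last v r hs he =>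
    obtain ⟨rfl, rfl⟩ := List.cons.inj hL
    subst he
    simp [cr]
  | cons v r s' L' hs hM hc h ih =>
    obtain ⟨rfl, rfl⟩ := List.cons.inj hL
    have h1 := cr_pos_trans hs h.step_pos (by have := h.start_lt; simpa using this) hc (ih rfl)
    have h2 : cr s (e - v) = cr s (e - (v + s)) := by simp [cr]; ring
    rw [h2]
    exact h1.le

theorem cr_head_pos {s' : ℤ × ℤ} (h : IsPath e M v (s :: s' :: L)) : 0 < cr s (e - v) := by
  cases h with
  | cons _ _ _ _ hs hM hc h =>
    have h1 := cr_pos_trans hs h.step_pos (by have := h.start_lt; simpa using this) hc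
      h.cr_head_nonneg
    have h2 : cr s (e - v) = cr s (e - (v + s)) := by simp [cr]; ring
    rwa [h2]

/-- The inner vertices lie above the chord. -/
theorem filter_chord (h : IsPath e M v L) (hM : ∀ p ∈ M, p.1 < e.1) :
    IsPath e (M.filter fun p => v.1 < p.1 ∧ 0 < cr (p - v) (e - v)) v L := by
  induction h with
  | last v s hs he => exact .last v s hs he
  | cons v s s' L hs hs' hc h ih =>
    have h0 : 0 < cr (v + s - v) (e - v) := by
      simpa using (IsPath.cons v s s' L hs hs' hc h).cr_head_pos
    have hw := h.start_lt
    refine .cons v s s' L hs ?_ hc (ih.mono ?_)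
    · simp only [Finset.mem_filter]
      exact ⟨hs', by simpa using hs, h0⟩
    · intro p hp
      simp only [Finset.mem_filter] at hp ⊢
      obtain ⟨hp, h1, h2⟩ := hp
      have h3 : v.1 < (v + s).1 := by simpa using hs
      exact ⟨hp, h3.trans h1, cr_chord_trans hw (h3.trans hw) (hM p hp) h0 h2⟩

/-- The vertices after the first one lie below the line through the first edge. -/
theorem filter_head (h : IsPath e M v (s :: L)) :
    IsPath e (M.filter fun p => v.1 < p.1 ∧ (p = v + s ∨ 0 < cr s (p - v))) v (s :: L) := by
  generalize hL : s :: L = L' at h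
  induction h generalizing s L with
  | last v r hs he => exact .last v r hs he
  | cons v r s' L' hs hM hc h ih =>
    obtain ⟨rfl, rfl⟩ := List.cons.inj hL
    refine .cons v s s' L' hs ?_ hc ((ih rfl).mono ?_)
    · simp only [Finset.mem_filter]
      exact ⟨hM, by simpa using hs, by simp⟩
    · intro p hp
      simp only [Finset.mem_filter] at hp ⊢
      obtain ⟨hp, h1, h2⟩ := hp
      have h3 : v.1 < (v + s).1 := by simpa using hs
      have h4 : cr s (p - v) = cr s (p - (v + s)) := by simp [cr]; ring
      refine ⟨hp, h3.trans h1, Or.inr ?_⟩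
      rw [h4]
      rcases h2 with h2 | h2
      · simpa [h2] using hc
      · exact cr_pos_trans hs h.step_pos (by simpa using h1) hc h2.le

/-- A concave path never dips below its chord. -/
theorem chord_of_above {p : ℤ × ℤ} (h : IsPath e M v L) (hv : v.1 < p.1) (hp : p.1 < e.1)
    (ha : Above v L p) : 0 < cr (p - v) (e - v) := by
  induction h with
  | last v s hs he =>
    subst he
    simp only [Prod.fst_add] at hp
    simpa [Above, hp.le] using ha
  | cons v s s' L hs hM hc h ih =>
    have h0 := (IsPath.cons v s s' L hs hM hc h).cr_head_pos
    have hw := h.start_lt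
    have hve := hv.trans hp
    rw [Above] at ha
    split_ifs at ha with hy
    · exact cr_pos_trans (by simpa using hv) hs (by simpa using hve) ha h0.le
    · exact cr_chord_trans hw hve hp (by simpa using h0) (ih (by simpa using hy) ha)

/-- Slopes decrease along the path, so every later edge runs below the line through the first one.
In the tie case, a point on that line must lie past the end of the first edge. -/
theorem above_of_head {u : ℤ × ℤ} (h : IsPath e M v (s :: L)) (hv : v.1 < u.1) (hu : u.1 ≤ e.1)
    (hs : 0 < cr (u - v) s ∨ cr (u - v) s = 0 ∧ v.1 + s.1 < u.1) : Above v (s :: L) u := by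
  generalize hL : s :: L = L' at h
  induction h generalizing s L with
  | last v r hr he =>
    obtain ⟨rfl, rfl⟩ := List.cons.inj hL
    subst he
    simp only [Prod.fst_add] at hu
    rw [Above, if_pos hu]
    rcases hs with hs | hs
    · exact hs
    · omega
  | cons v r s' L' hr hM hc h ih =>
    obtain ⟨rfl, rfl⟩ := List.cons.inj hL
    rw [Above]
    split_ifs with hy
    · rcases hs with hs | hs
      · exact hs
      · omega
    · have h1 : 0 ≤ cr (u - v) s := hs.elim le_of_lt fun h => h.1.ge
      have h2 : cr (u - v) s = cr (u - (v + s)) s := by simp [cr]; ring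
      rw [h2] at h1
      have h3 : (v + s).1 < u.1 := by simpa using hy
      exact ih (s := s') h3 (Or.inl (cr_pos_trans' (by simpa using h3) hr h.step_pos h1 hc)) rfl

end IsPath

/-! ### The weights of all paths sum to one -/

/-- In a finite set of points to the right of `v` there is a point of largest slope seen from `v`,
and a farthest one among those. -/
theorem exists_steepest {M : Finset (ℤ × ℤ)} (v : ℤ × ℤ) (hM : M.Nonempty)
    (hv : ∀ p ∈ M, v.1 < p.1) :
    ∃ u ∈ M, ∀ p ∈ M, p ≠ u → 0 < cr (u - v) (p - v) ∨ cr (u - v) (p - v) = 0 ∧ p.1 < u.1 := by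
  obtain ⟨u, hu, h⟩ := M.exists_max_image
    -- Only first coordinates are known to be positive, so a / b is maximized through -b / a; the
    -- second lexicographic entry breaks ties by distance.
    (fun p => toLex (-((p.2 - v.2 : ℤ) : ℚ) / ((p.1 - v.1 : ℤ) : ℚ), p.1)) hM
  refine ⟨u, hu, fun p hp hpu => ?_⟩
  have h1 := h p hp
  have hu1 : (0 : ℚ) < ((u.1 - v.1 : ℤ) : ℚ) := by have := hv u hu; exact_mod_cast (by omega)
  have hp1 : (0 : ℚ) < ((p.1 - v.1 : ℤ) : ℚ) := by have := hv p hp; exact_mod_cast (by omega)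
  rw [Prod.Lex.toLex_le_toLex] at h1
  simp only [div_lt_div_iff₀ hp1 hu1, div_eq_div_iff hp1.ne' hu1.ne'] at h1
  norm_cast at h1
  simp only [cr, Prod.fst_sub, Prod.snd_sub]
  rcases h1 with h1 | ⟨h1, h2⟩
  · left; linarith
  · refine Or.inr ⟨by linarith, lt_of_le_of_ne h2 fun h3 => hpu ?_⟩
    rw [h3] at h1
    have h4 : u.1 - v.1 ≠ 0 := by have := hv u hu; omega
    have h5 := mul_right_cancel₀ h4 h1
    exact Prod.ext h3 (by omega)

open Classical in
/-- Choosing every point of `M` independently with probability `1 - t`, the concave hull of the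
chosen points is some path; the summands are the probabilities of the paths. -/
theorem sum_paths {R : Type*} [CommRing R] (t : R) (e : ℤ × ℤ) (M : Finset (ℤ × ℤ)) (v : ℤ × ℤ)
    (hve : v.1 < e.1) (hM : ∀ p ∈ M, v.1 < p.1 ∧ p.1 < e.1 ∧ 0 < cr (p - v) (e - v))
    (S : Finset (List (ℤ × ℤ))) (hS : ∀ L, L ∈ S ↔ IsPath e M v L) :
    ∑ L ∈ S, (1 - t) ^ (L.length - 1) * t ^ (M.filter (Above v L)).card = 1 := by
  induction hn : M.card using Nat.strong_induction_on generalizing M v S with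
  | _ n ih =>
  subst hn
  rcases M.eq_empty_or_nonempty with rfl | hne
  · have : S = {[e - v]} := by
      ext L
      rw [hS, Finset.mem_singleton]
      constructor
      · intro h
        cases h with
        | last _ s hs he => rw [← he]; simp
        | cons _ _ _ _ _ hM => simp at hM
      · rintro rfl
        exact .last _ _ (by simpa using hve) (by simp)
    simp [this]
  obtain ⟨u, hu, hmax⟩ := exists_steepest v hne fun p hp => (hM p hp).1
  obtain ⟨huv, hue, huc⟩ := hM u hu
  have huv' : 0 < (u - v).1 := by simpa using huv
  have hvu : v + (u - v) = u := by simp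
  -- The points that still matter once `u` is a vertex: those beyond `u` and above the chord from
  -- `u` to `e`.
  set M' := M.filter fun p => u.1 < p.1 ∧ 0 < cr (p - u) (e - u) with hM'
  have hinj : Function.Injective (List.cons (u - v)) := List.cons_injective
  set S' := S.preimage (List.cons (u - v)) hinj.injOn with hS'
  -- A path not going straight to `u` avoids `u` altogether: otherwise `u` would lie strictly below
  -- its first edge, against maximality.
  have hfirst : ∀ s L, IsPath e M v (s :: L) → s ≠ u - v → IsPath e (M.erase u) v (s :: L) := by
    intro s L h hs
    cases h with
    | last _ _ hs he => exact .last _ _ hs he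
    | cons _ _ s' L hs' hM1 hc h =>
      refine (IsPath.cons _ _ s' L hs' hM1 hc h).filter_head.mono fun p hp => ?_
      simp only [Finset.mem_filter, Finset.mem_erase] at hp ⊢
      refine ⟨?_, hp.1⟩
      rintro rfl
      rcases hp.2.2 with h1 | h1
      · exact hs (by rw [h1]; simp)
      · have h2 := hmax (v + s) hM1 (by rintro rfl; simp at hs)
        have h3 : cr (p - v) (v + s - v) = - cr s (p - v) := by simp [cr]
        rw [h3] at h2
        omega
  have hthrough : ∀ L, IsPath e M v ((u - v) :: L) ↔ IsPath e M' u L := by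
    intro L
    constructor
    · intro h
      cases h with
      | last _ _ hs he => rw [hvu] at he; subst he; simp at hue
      | cons _ _ s' L hs' hM1 hc h =>
        rw [hvu] at h
        exact h.filter_chord fun p hp => (hM p hp).2.1
    · intro h
      obtain ⟨s', L, rfl⟩ := List.exists_cons_of_ne_nil h.ne_nil
      refine .cons _ _ _ _ huv' (by rwa [hvu]) ?_
        (by rw [hvu]; exact h.mono (Finset.filter_subset _ _))
      cases h with
      | last _ _ hs he =>
        have : cr (u - v) s' = cr (u - v) (e - v) := by rw [← he]; simp [cr]; ring
        rwa [this]
      | cons _ _ s' L hs' hM1 hc h =>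
        obtain ⟨h1, h2, -⟩ := Finset.mem_filter.1 hM1
        -- A tie in slope would put this vertex before `u`, but members of `M'` lie beyond `u`.
        have h3 := hmax _ h1 (by intro h; rw [h] at h2; exact lt_irrefl _ h2)
        have h4 : ∀ r, cr (u - v) (u + r - v) = cr (u - v) r := by intro r; simp [cr]; ring
        rw [h4] at h3
        omega
  have hS'mem : ∀ L, L ∈ S' ↔ IsPath e M' u L := by
    intro L
    rw [hS', Finset.mem_preimage, hS, hthrough]
  have ih1 := ih _ (Finset.card_lt_card (Finset.erase_ssubset hu)) (M.erase u) v hve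
    (fun p hp => hM p (Finset.mem_of_mem_erase hp)) (S.filter fun L => L.head? ≠ some (u - v))
    (by
      intro L
      rw [Finset.mem_filter, hS]
      constructor
      · rintro ⟨h, hL⟩
        obtain ⟨s, L, rfl⟩ := List.exists_cons_of_ne_nil h.ne_nil
        exact hfirst s L h (by simpa using hL)
      · intro h
        refine ⟨h.mono (Finset.erase_subset _ _), fun hL => ?_⟩
        obtain ⟨s, L, rfl⟩ := List.exists_cons_of_ne_nil h.ne_nil
        obtain rfl : s = u - v := by simpa using hL
        cases h with
        | last _ _ hs he => rw [hvu] at he; subst he; simp at hue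
        | cons _ _ _ _ _ hM1 => simp at hM1) rfl
  have hM'lt : M'.card < M.card := by
    refine Finset.card_lt_card (Finset.filter_ssubset.2 ⟨u, hu, ?_⟩)
    simp
  have ih2 := ih _ hM'lt M' u hue
    (fun p hp => by
      rw [hM', Finset.mem_filter] at hp
      exact ⟨hp.2.1, (hM p hp.1).2.1, hp.2.2⟩) S' hS'mem rfl
  have hsplit : S.filter (fun L => L.head? = some (u - v)) = S'.image (List.cons (u - v)) := by
    ext L
    simp only [Finset.mem_filter, Finset.mem_image, hS', Finset.mem_preimage]
    constructor
    · rintro ⟨h, hL⟩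
      obtain ⟨s, L, rfl⟩ := List.exists_cons_of_ne_nil ((hS L).1 h).ne_nil
      obtain rfl : s = u - v := by simpa using hL
      exact ⟨L, h, rfl⟩
    · rintro ⟨L, h, rfl⟩
      exact ⟨h, rfl⟩
  rw [← Finset.sum_filter_add_sum_filter_not S (fun L => L.head? = some (u - v)), hsplit,
    Finset.sum_image hinj.injOn]
  -- Case `u` chosen: one more inner vertex. By maximality no point of `M` lies strictly above the
  -- edge from `v` to `u`, so the points above are those above the remaining path.
  have e1 : ∀ L ∈ S', (1 - t) ^ (((u - v) :: L).length - 1) *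
      t ^ (M.filter (Above v ((u - v) :: L))).card =
      (1 - t) * ((1 - t) ^ (L.length - 1) * t ^ (M'.filter (Above u L)).card) := by
    intro L hL
    have hp := (hS'mem L).1 hL
    obtain ⟨s', L, rfl⟩ := List.exists_cons_of_ne_nil hp.ne_nil
    have : M.filter (Above v ((u - v) :: s' :: L)) = M'.filter (Above u (s' :: L)) := by
      ext p
      simp only [hM', Finset.mem_filter, and_assoc]
      refine and_congr_right fun hpM => ?_
      rw [Above, hvu]
      split_ifs with hy
      · have h1 : ¬ u.1 < p.1 := by simp at hy; omega
        simp only [h1, false_and, iff_false]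
        intro h2
        have h3 : cr (p - v) (u - v) = - cr (u - v) (p - v) := by simp [cr]
        rw [h3] at h2
        by_cases h4 : p = u
        · simp [h4, cr] at h2
        · have := hmax p hpM h4
          omega
      · have h1 : u.1 < p.1 := by simp at hy; omega
        simp only [h1, true_and]
        exact ⟨fun h => ⟨hp.chord_of_above h1 (hM p hpM).2.1 h, h⟩, fun h => h.2⟩
    rw [this]
    simp only [List.length_cons, Nat.add_sub_cancel]
    ring
  -- Case `u` not chosen: `u` is strictly above every path avoiding it, which accounts for one
  -- factor `t`.
  have e2 : ∀ L ∈ S.filter (fun L => ¬ L.head? = some (u - v)),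
      (1 - t) ^ (L.length - 1) * t ^ (M.filter (Above v L)).card =
      t * ((1 - t) ^ (L.length - 1) * t ^ ((M.erase u).filter (Above v L)).card) := by
    intro L hL
    rw [Finset.mem_filter, hS] at hL
    obtain ⟨h, hL⟩ := hL
    obtain ⟨s, L, rfl⟩ := List.exists_cons_of_ne_nil h.ne_nil
    have hs : s ≠ u - v := by simpa using hL
    have hab : Above v (s :: L) u := by
      refine h.above_of_head huv hue.le ?_
      cases h with
      | last _ _ hs he => subst he; left; simpa using huc
      | cons _ _ _ _ _ hM1 =>
        have := hmax _ hM1 (by rintro rfl; simp at hs)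
        simpa using this
    rw [Finset.filter_erase, Finset.card_erase_of_mem (Finset.mem_filter.2 ⟨hu, hab⟩)]
    obtain ⟨m, hm⟩ := Nat.exists_eq_add_of_lt
      (Finset.card_pos.2 ⟨u, Finset.mem_filter.2 ⟨hu, hab⟩⟩)
    rw [hm]
    simp only [zero_add, Nat.add_sub_cancel]
    ring
  rw [Finset.sum_congr rfl e1, Finset.sum_congr rfl e2, ← Finset.mul_sum, ← Finset.mul_sum, ih1,
    ih2]
  ring

/-! ### Lattice points beside one edge -/

theorem card_filter_dvd_mul (a b : ℕ) (ha : 0 < a) :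
    ((Finset.Ioc 0 a).filter fun m => a ∣ b * m).card = Nat.gcd a b := by
  have hg : 0 < Nat.gcd a b := Nat.gcd_pos_of_pos_left b ha
  have h : ∀ m, a ∣ b * m ↔ a / Nat.gcd a b ∣ m := by
    intro m
    obtain ⟨g, a', b', hg', hco, rfl, rfl⟩ := Nat.exists_coprime' (m := a) (n := b) hg
    rw [Nat.gcd_mul_right, hco.gcd_eq_one, one_mul, Nat.mul_div_cancel _ hg', mul_right_comm,
      Nat.mul_dvd_mul_iff_right hg']
    exact hco.dvd_mul_left
  simp only [h]
  rw [Nat.Ioc_filter_dvd_card_eq_div, Nat.div_div_self (Nat.gcd_dvd_left a b) ha.ne']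

theorem ceil_add_ceil_neg (x : ℚ) : ⌈x⌉ + ⌈-x⌉ = if x = (⌊x⌋ : ℚ) then 0 else 1 := by
  rw [Int.ceil_neg]
  split_ifs with h
  · rw [h]; simp
  · have : ⌈x⌉ = ⌊x⌋ + 1 := by
      rw [Int.ceil_eq_iff]
      push_cast
      exact ⟨by simpa using lt_of_le_of_ne (Int.floor_le x) (Ne.symm h), (Int.lt_floor_add_one x).le⟩
    omega

/-- Pair m with a - m: the ceilings of x = bm / a and of b - x add up to b + 1, or to b when x is an
integer, which happens for gcd(a, b) values of m. -/
theorem two_mul_sum_ceil (a b : ℕ) (ha : 0 < a) :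
    2 * ∑ m ∈ Finset.Ioc 0 a, ⌈((b * m : ℕ) : ℚ) / a⌉ = (a * b + a + b - Nat.gcd a b : ℤ) := by
  have ha' : (a : ℚ) ≠ 0 := by positivity
  set f : ℕ → ℤ := fun m => ⌈((b * m : ℕ) : ℚ) / a⌉ with hf
  have h1 : ∑ m ∈ Finset.range (a + 1), f m = ∑ m ∈ Finset.Ioc 0 a, f m := by
    rw [Finset.range_eq_Ico, Finset.sum_eq_sum_Ico_succ_bot (by omega)]
    simp only [hf, Nat.mul_zero, Nat.cast_zero, zero_div, Int.ceil_zero, zero_add]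
    rfl
  have h2 : ∑ m ∈ Finset.range (a + 1), f (a - m) = ∑ m ∈ Finset.range (a + 1), f m := by
    simpa using Finset.sum_range_reflect f (a + 1)
  have h3 : ∀ m ∈ Finset.Ioc 0 a, f m + f (a - m) = b + 1 - if a ∣ b * m then 1 else 0 := by
    intro m hm
    have hm' : m ≤ a := (Finset.mem_Ioc.1 hm).2
    have e1 : ((b * (a - m) : ℕ) : ℚ) / a = -(((b * m : ℕ) : ℚ) / a) + (b : ℤ) := by
      push_cast [Nat.cast_sub hm']
      field_simp
      ring
    have e2 : ((b * m : ℕ) : ℚ) / a = (⌊((b * m : ℕ) : ℚ) / a⌋ : ℚ) ↔ a ∣ b * m := by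
      constructor
      · intro h
        rw [div_eq_iff ha'] at h
        have h' : ((b * m : ℕ) : ℤ) = ⌊((b * m : ℕ) : ℚ) / a⌋ * a := by exact_mod_cast h
        exact Int.natCast_dvd_natCast.1 (Dvd.intro_left _ h'.symm)
      · rintro ⟨c, hc⟩
        rw [hc]
        have : ((a * c : ℕ) : ℚ) / a = (c : ℤ) := by push_cast; field_simp
        rw [this, Int.floor_intCast]
    have e3 := ceil_add_ceil_neg (((b * m : ℕ) : ℚ) / a)
    simp only [e2] at e3
    simp only [hf]
    rw [e1, Int.ceil_add_intCast, ← add_assoc, e3]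
    split_ifs <;> ring
  -- Reflection swaps the end terms f 0 = 0 and f a = b, hence the extra b.
  have h4 : ∑ m ∈ Finset.range (a + 1), f (a - m) = b + ∑ m ∈ Finset.Ioc 0 a, f (a - m) := by
    rw [Finset.range_eq_Ico, Finset.sum_eq_sum_Ico_succ_bot (by omega)]
    congr 1
    simp only [hf, Nat.sub_zero]
    have : ((b * a : ℕ) : ℚ) / a = (b : ℤ) := by push_cast; field_simp
    rw [this, Int.ceil_intCast]
  have h5 := Finset.sum_congr rfl h3
  rw [Finset.sum_add_distrib, Finset.sum_sub_distrib, Finset.sum_const, Nat.card_Ioc,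
    Finset.sum_boole, card_filter_dvd_mul a b ha] at h5
  simp only [nsmul_eq_mul, Nat.sub_zero] at h5
  linarith

/-- The number of points `(v.1 + m, x)` with `v.1 + m < x` to the left of the edge from `v` with
step `s`. -/
theorem card_row (v s : ℤ × ℤ) (m n : ℤ) (hs : 0 < s.1) (hss : s.1 < s.2) (hv : v.1 ≤ v.2)
    (hm : 0 < m) (hms : m ≤ s.1) (hn : v.2 + s.2 ≤ n) :
    (((Finset.Ioo (v.1 + m) n).filter fun x => 0 < cr ((v.1 + m, x) - v) s).card : ℤ) =
      ⌈((s.2 * m : ℤ) : ℚ) / s.1⌉ + (v.2 - v.1) - m - 1 := by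
  have hs' : (0 : ℚ) < s.1 := by exact_mod_cast hs
  -- These two bounds make the constraint x < n redundant and keep the length of the interval from
  -- being truncated at zero.
  have h1 : ⌈((s.2 * m : ℤ) : ℚ) / s.1⌉ ≤ s.2 := by
    rw [Int.ceil_le, div_le_iff₀ hs']
    exact_mod_cast (by nlinarith)
  have h2 : m < ⌈((s.2 * m : ℤ) : ℚ) / s.1⌉ := by
    rw [Int.lt_ceil, lt_div_iff₀ hs']
    exact_mod_cast (by nlinarith)
  have h3 : ((Finset.Ioo (v.1 + m) n).filter fun x => 0 < cr ((v.1 + m, x) - v) s) =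
      Finset.Ioo (v.1 + m) (v.2 + ⌈((s.2 * m : ℤ) : ℚ) / s.1⌉) := by
    ext x
    simp only [Finset.mem_filter, Finset.mem_Ioo]
    have : 0 < cr ((v.1 + m, x) - v) s ↔ x < v.2 + ⌈((s.2 * m : ℤ) : ℚ) / s.1⌉ := by
      rw [← sub_lt_iff_lt_add', Int.lt_ceil, lt_div_iff₀ hs']
      norm_cast
      simp only [cr, Prod.fst_sub, Prod.snd_sub, add_sub_cancel_left]
      constructor <;> intro h <;> linarith
    rw [this]
    constructor
    · rintro ⟨⟨h4, h5⟩, h6⟩; exact ⟨h4, h6⟩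
    · rintro ⟨h4, h6⟩; exact ⟨⟨h4, by omega⟩, h6⟩
  rw [h3, Int.card_Ioo, Int.toNat_of_nonneg (by omega)]
  ring

theorem sum_Ioc_eq_nat {f : ℤ → ℤ} (v : ℤ) (a : ℕ) :
    ∑ y ∈ Finset.Ioc v (v + a), f y = ∑ m ∈ Finset.Ioc 0 a, f (v + m) := by
  symm
  refine Finset.sum_bij (fun m _ => v + (m : ℤ)) ?_ ?_ ?_ ?_
  · intro m hm; simp at hm ⊢; omega
  · intro m _ m' _ h; simpa using h
  · intro y hy
    simp only [Finset.mem_Ioc] at hy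
    exact ⟨(y - v).toNat, by simp; omega, by omega⟩
  · intro _ _; rfl

/-- The number of points left of an edge, counted by rows. -/
theorem two_mul_sum_card_edge (v s : ℤ × ℤ) (n : ℤ) (hs : 0 < s.1) (hss : s.1 < s.2)
    (hv : v.1 ≤ v.2) (hn : v.2 + s.2 ≤ n) :
    2 * ∑ y ∈ Finset.Ioc v.1 (v.1 + s.1),
      (((Finset.Ioo y n).filter fun x => 0 < cr ((y, x) - v) s).card : ℤ) =
      s.1 * (s.2 - s.1) + 2 * s.1 * (v.2 - v.1) + (s.2 - 2 * s.1) - Int.gcd s.1 s.2 := by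
  obtain ⟨v1, v2⟩ := v
  obtain ⟨s1, s2⟩ := s
  dsimp only at *
  lift s1 to ℕ using hs.le
  lift s2 to ℕ using by omega
  rw [sum_Ioc_eq_nat]
  have h1 : ∀ m ∈ Finset.Ioc 0 s1, (((Finset.Ioo (v1 + (m : ℤ)) n).filter fun x =>
      0 < cr ((v1 + (m : ℤ), x) - (v1, v2)) ((s1 : ℤ), (s2 : ℤ))).card : ℤ) =
      ⌈((s2 * m : ℕ) : ℚ) / s1⌉ + ((v2 - v1 - 1) - (m : ℤ)) := by
    intro m hm
    rw [Finset.mem_Ioc] at hm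
    have := card_row (v1, v2) ((s1 : ℤ), (s2 : ℤ)) m n hs hss hv (by omega) (by dsimp only; omega) hn
    dsimp only at this
    rw [this]
    push_cast
    ring
  rw [Finset.sum_congr rfl h1, Finset.sum_add_distrib, mul_add,
    two_mul_sum_ceil s1 s2 (by omega), Finset.sum_sub_distrib, Finset.sum_const, Nat.card_Ioc]
  have h2 : 2 * ∑ m ∈ Finset.Ioc 0 s1, (m : ℤ) = s1 * (s1 + 1) := by
    clear * -
    induction s1 with
    | zero => simp
    | succ k ih =>
      rw [Finset.sum_Ioc_succ_top (by omega), mul_add, ih]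
      push_cast
      ring
  rw [mul_sub, h2, Int.gcd_natCast_natCast]
  simp only [nsmul_eq_mul, Nat.sub_zero]
  ring

/-! ### Lattice points above a whole path -/

/-- The sum of the cross products of all pairs of steps. -/
def crossSum : List (ℤ × ℤ) → ℤ
  | [] => 0
  | s :: L => cr s L.sum + crossSum L

/-- The sum of the greatest common divisors of the coordinates of the steps. -/
def gcdSum (L : List (ℤ × ℤ)) : ℤ := (L.map fun s => (Int.gcd s.1 s.2 : ℤ)).sum

open Classical in
/-- The number of points in the interior of the triangle above a path. -/
theorem two_mul_sum_card_above (e : ℤ × ℤ) (L : List (ℤ × ℤ)) (v : ℤ × ℤ) (hL : L ≠ [])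
    (hs : ∀ s ∈ L, 0 < s.1 ∧ s.1 < s.2) (hv : v.1 ≤ v.2) (he : v + L.sum = e) :
    2 * ∑ y ∈ Finset.Ioo v.1 e.1,
      (((Finset.Ioo y e.2).filter fun x => Above v L (y, x)).card : ℤ) =
      L.sum.1 * (L.sum.2 - L.sum.1) + 2 * L.sum.1 * (v.2 - v.1) + (L.sum.2 - 2 * L.sum.1)
        - crossSum L - gcdSum L - 2 * (e.2 - e.1 - 1) := by
  induction L generalizing v with
  | nil => exact absurd rfl hL
  | cons s L ih =>
    obtain ⟨hs1, hs2⟩ := hs s (by simp)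
    have hLs : 0 ≤ L.sum.1 ∧ 0 ≤ L.sum.2 ∧ (L ≠ [] → 0 < L.sum.1) := by
      clear ih hL he
      induction L with
      | nil => simp
      | cons r L ih =>
        have h1 := ih fun s hs' => hs s (by simp at hs' ⊢; tauto)
        have h2 := hs r (by simp)
        simp only [List.sum_cons, Prod.fst_add, Prod.snd_add]
        exact ⟨by omega, by omega, fun _ => by omega⟩
    have he1 : v.1 + s.1 + L.sum.1 = e.1 := by rw [← he]; simp; ring
    have he2 : v.2 + s.2 + L.sum.2 = e.2 := by rw [← he]; simp; ring
    have hedge := two_mul_sum_card_edge v s e.2 hs1 hs2 hv (by omega)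
    have hrow : ∀ y ∈ Finset.Ioc v.1 (v.1 + s.1),
        (((Finset.Ioo y e.2).filter fun x => Above v (s :: L) (y, x)).card : ℤ) =
        (((Finset.Ioo y e.2).filter fun x => 0 < cr ((y, x) - v) s).card : ℤ) := by
      intro y hy
      congr 2
      ext x
      rw [Finset.mem_Ioc] at hy
      simp only [Finset.mem_filter, Above, if_pos hy.2]
    rw [← Finset.sum_congr rfl hrow] at hedge
    rcases eq_or_ne L [] with rfl | hne
    · simp only [List.sum_nil, Prod.fst_zero, Prod.snd_zero, add_zero] at he1 he2
      -- The edge count includes the top row `e.1`, which is outside the open triangle; its e.2 -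
      -- e.1 - 1 points are the correction term of the formula.
      have hsplit : Finset.Ioc v.1 (v.1 + s.1) = insert e.1 (Finset.Ioo v.1 e.1) := by
        ext y; simp only [Finset.mem_insert, Finset.mem_Ioc, Finset.mem_Ioo]; omega
      have hlast := hrow e.1 (by simp; omega)
      have hr := card_row v s s.1 e.2 hs1 hs2 hv hs1 le_rfl (by omega)
      rw [he1] at hr
      have hc : ⌈((s.2 * s.1 : ℤ) : ℚ) / s.1⌉ = s.2 := by
        have : ((s.2 * s.1 : ℤ) : ℚ) / s.1 = (s.2 : ℤ) := by
          have : (s.1 : ℚ) ≠ 0 := by exact_mod_cast hs1.ne'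
          push_cast; field_simp
        rw [this, Int.ceil_intCast]
      rw [hsplit, Finset.sum_insert (by simp), hlast, hr, hc] at hedge
      simp only [List.sum_cons, List.sum_nil, add_zero, crossSum, gcdSum, List.map_cons,
        List.map_nil, cr, Prod.fst_zero, Prod.snd_zero]
      linarith
    · have hpos := hLs.2.2 hne
      have ih' := ih (v + s) hne (fun r hr => hs r (by simp [hr]))
        (by simp; omega) (by rw [← he]; simp [add_assoc])
      have hsplit : Finset.Ioo v.1 e.1 =
          Finset.Ioc v.1 (v.1 + s.1) ∪ Finset.Ioo (v + s).1 e.1 := by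
        ext y; simp only [Finset.mem_union, Finset.mem_Ioc, Finset.mem_Ioo, Prod.fst_add]; omega
      have hdisj : Disjoint (Finset.Ioc v.1 (v.1 + s.1)) (Finset.Ioo (v + s).1 e.1) := by
        rw [Finset.disjoint_left]
        intro y hy hy'
        simp only [Finset.mem_Ioc, Finset.mem_Ioo, Prod.fst_add] at hy hy'
        omega
      have hrest : ∀ y ∈ Finset.Ioo (v + s).1 e.1,
          (((Finset.Ioo y e.2).filter fun x => Above v (s :: L) (y, x)).card : ℤ) =
          (((Finset.Ioo y e.2).filter fun x => Above (v + s) L (y, x)).card : ℤ) := by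
        intro y hy
        congr 2
        ext x
        simp only [Finset.mem_Ioo, Prod.fst_add] at hy
        simp only [Finset.mem_filter, Above, if_neg (not_le.2 hy.1)]
      rw [hsplit, Finset.sum_union hdisj, mul_add, hedge, Finset.sum_congr rfl hrest, ih']
      simp only [List.sum_cons, crossSum, gcdSum, List.map_cons, cr, Prod.fst_add, Prod.snd_add]
      ring

/-! ### Paths in the triangle -/

/-- The points of the open triangle with vertices `(0, 0)`, `(e.1, e.1)` and `e`. -/
noncomputable def triangle (e : ℤ × ℤ) : Finset (ℤ × ℤ) :=
  (Finset.Ioo 0 e.1 ×ˢ Finset.Ioo 0 e.2).filter fun p => p.1 < p.2 ∧ 0 < cr p e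

namespace IsPath

variable {e v : ℤ × ℤ} {M : Finset (ℤ × ℤ)} {L : List (ℤ × ℤ)}

theorem forall_pos (h : IsPath e M v L) : ∀ s ∈ L, 0 < s.1 := by
  induction h with
  | last v s hs he => simpa using hs
  | cons v s s' L hs hM hc h ih => exact List.forall_mem_cons.2 ⟨hs, ih⟩

theorem start_add_sum (h : IsPath e M v L) : v + L.sum = e := by
  induction h with
  | last v s hs he => simpa using he
  | cons v s s' L hs hM hc h ih => rw [List.sum_cons, ← add_assoc, ih]

theorem pairwise (h : IsPath e M v L) : L.Pairwise fun p q => 0 < cr p q := by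
  induction h with
  | last v s hs he => simp
  | cons v s s' L hs hM hc h ih =>
    refine List.pairwise_cons.2 ⟨fun r hr => ?_, ih⟩
    rcases List.mem_cons.1 hr with rfl | hr'
    · exact hc
    · exact cr_pos_trans hs h.step_pos (h.forall_pos r hr) hc ((List.pairwise_cons.1 ih).1 r hr').le

theorem forall_lt (he : e.1 < e.2) (h : IsPath e (triangle e) 0 L) : ∀ s ∈ L, s.1 < s.2 := by
  obtain ⟨s, L, rfl⟩ := List.exists_cons_of_ne_nil h.ne_nil
  have hs : s.1 < s.2 := by
    cases h with
    | last _ _ hs h => rw [zero_add] at h; rwa [h]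
    | cons _ _ s' L hs hM hc h =>
      rw [zero_add] at hM
      exact (Finset.mem_filter.1 hM).2.1
  refine List.forall_mem_cons.2 ⟨hs, fun r hr => ?_⟩
  have h1 := (List.pairwise_cons.1 h.pairwise).1 r hr
  have h2 := h.forall_pos r (by simp [hr])
  have h3 := h.step_pos
  rw [cr] at h1
  nlinarith

/-- The chord condition is left out here so that the vertex set does not depend on the moving start
`v`; `filter_chord` restores it in `triangle_iff`. -/
theorem of_pairwise (hL : L ≠ []) (hs : ∀ s ∈ L, 0 < s.1 ∧ s.1 < s.2) (hv : 0 ≤ v.1)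
    (hv' : v.1 ≤ v.2) (he : v + L.sum = e) (hp : L.Pairwise fun p q => 0 < cr p q) :
    IsPath e ((Finset.Ioo 0 e.1 ×ˢ Finset.Ioo 0 e.2).filter fun p => p.1 < p.2) v L := by
  induction L generalizing v with
  | nil => exact absurd rfl hL
  | cons s L ih =>
    obtain ⟨hs1, hs2⟩ := hs s (by simp)
    cases L with
    | nil => exact .last v s hs1 (by simpa using he)
    | cons s' L =>
      have h := ih (v := v + s) (by simp) (fun r hr => hs r (List.mem_cons_of_mem _ hr))
        (by simp; omega) (by simp; omega) (by rw [← he]; simp [add_assoc]) hp.of_cons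
      refine .cons v s s' L hs1 ?_ ((List.pairwise_cons.1 hp).1 s' (by simp)) h
      have h1 := h.start_lt
      have h2 : (v + s).2 < e.2 := by
        have h3 : 0 ≤ L.sum.2 := by
          have : ∀ K : List (ℤ × ℤ), (∀ r ∈ K, 0 ≤ r.2) → 0 ≤ K.sum.2 := by
            intro K hK
            induction K with
            | nil => simp
            | cons r K ih =>
              have h1 := hK r (by simp)
              have h2 := ih fun r hr => hK r (by simp [hr])
              simp only [List.sum_cons, Prod.snd_add]
              omega
          exact this L fun r hr => by have := hs r (by simp [hr]); omega
        have h4 := hs s' (by simp)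
        rw [← he]
        simp only [List.sum_cons, Prod.snd_add]
        omega
      simp only [Prod.fst_add, Prod.snd_add] at h1 h2
      simp only [Finset.mem_filter, Finset.mem_product, Finset.mem_Ioo, Prod.fst_add, Prod.snd_add]
      omega

theorem triangle_iff (he : e.1 < e.2) : IsPath e (triangle e) 0 L ↔
    L ≠ [] ∧ (∀ s ∈ L, 0 < s.1 ∧ s.1 < s.2) ∧ L.sum = e ∧ L.Pairwise fun p q => 0 < cr p q := by
  constructor
  · intro h
    exact ⟨h.ne_nil, fun s hs => ⟨h.forall_pos s hs, h.forall_lt he s hs⟩,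
      by simpa using h.start_add_sum, h.pairwise⟩
  · rintro ⟨h1, h2, h3, h4⟩
    have h := of_pairwise (v := 0) h1 h2 le_rfl le_rfl (by simpa using h3) h4
    refine (h.filter_chord fun p hp => ?_).mono fun p hp => ?_
    · simp only [Finset.mem_filter, Finset.mem_product, Finset.mem_Ioo] at hp
      exact hp.1.1.2
    · simp only [sub_zero, Finset.mem_filter] at hp
      simp only [triangle, Finset.mem_filter]
      exact ⟨hp.1.1, hp.1.2, hp.2.2⟩

-- Fibre over the first coordinate; by `chord_of_above` the chord condition of the triangle is
-- automatic for points above the path.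
open Classical in
theorem card_filter_above (h : IsPath e (triangle e) 0 L) :
    (((triangle e).filter (Above 0 L)).card : ℤ) =
      ∑ y ∈ Finset.Ioo 0 e.1, (((Finset.Ioo y e.2).filter fun x => Above 0 L (y, x)).card : ℤ) := by
  rw [Finset.card_eq_sum_card_fiberwise (f := Prod.fst) (t := Finset.Ioo 0 e.1)]
  · push_cast
    refine Finset.sum_congr rfl fun y hy => ?_
    rw [Finset.mem_Ioo] at hy
    rw [← Finset.card_image_of_injective ((Finset.Ioo y e.2).filter fun x => Above 0 L (y, x))
      (Prod.mk_right_injective y)]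
    refine congrArg (fun A : Finset (ℤ × ℤ) => (A.card : ℤ)) ?_
    ext ⟨y', x⟩
    simp only [triangle, Finset.mem_filter, Finset.mem_image, Finset.mem_product, Finset.mem_Ioo,
      Prod.mk.injEq]
    constructor
    · rintro ⟨⟨⟨⟨h1, h2⟩, h3, h4⟩, h5⟩, rfl⟩
      exact ⟨x, ⟨⟨h3, h2.2⟩, h5⟩, rfl, rfl⟩
    · rintro ⟨x', ⟨⟨h1, h2⟩, h3⟩, rfl, rfl⟩
      have h4 := h.chord_of_above (p := (y, x')) (by simpa using hy.1) hy.2 h3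
      rw [sub_zero, sub_zero] at h4
      exact ⟨⟨⟨⟨hy, by omega, h2⟩, h1, h4⟩, h3⟩, rfl⟩
  · intro p hp
    simp only [triangle, Finset.coe_filter, Finset.mem_filter, Finset.mem_product,
      Set.mem_ofPred_eq] at hp
    exact hp.1.1.1

end IsPath

/-! ### Translation of the index set and conclusion -/

/-- The list of integer vectors given by a sequence of pairs of natural numbers. -/
def steps (s : Σ k : ℕ, Fin k → ℕ × ℕ) : List (ℤ × ℤ) :=
  List.ofFn fun l => (((s.2 l).1 : ℤ), ((s.2 l).2 : ℤ))

theorem steps_eq_map (s : Σ k : ℕ, Fin k → ℕ × ℕ) :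
    steps s = (List.ofFn s.2).map (Prod.map Nat.cast Nat.cast) := by
  rw [steps, List.map_ofFn]
  rfl

theorem steps_injective : Function.Injective steps := by
  intro s s' h
  rw [steps_eq_map, steps_eq_map] at h
  have h1 := List.map_injective_iff.2 (Nat.cast_injective.prodMap Nat.cast_injective) h
  exact List.equivSigmaTuple.symm.injective h1

theorem sum_steps (s : Σ k : ℕ, Fin k → ℕ × ℕ) :
    (steps s).sum = (((∑ l, (s.2 l).1 : ℕ) : ℤ), ((∑ l, (s.2 l).2 : ℕ) : ℤ)) := by
  rw [steps, List.sum_ofFn]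
  ext <;> simp [Prod.fst_sum, Prod.snd_sum]

theorem mem_indexSet_iff (i n : ℕ) (s : Σ k : ℕ, Fin k → ℕ × ℕ) :
    s ∈ indexSet i n ↔ steps s ≠ [] ∧ (∀ r ∈ steps s, 0 < r.1 ∧ r.1 < r.2) ∧
      (steps s).sum = ((i : ℤ), (n : ℤ)) ∧ (steps s).Pairwise fun p q => 0 < cr p q := by
  have h1 : 1 ≤ s.1 ↔ steps s ≠ [] := by
    rw [← List.length_pos_iff, steps, List.length_ofFn]
    rfl
  have h2 : (∀ r ∈ steps s, 0 < r.1 ∧ r.1 < r.2) ↔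
      ∀ l, 0 < (s.2 l).1 ∧ (s.2 l).1 < (s.2 l).2 := by
    rw [steps, List.forall_mem_ofFn_iff]
    simp
  have h3 : (steps s).sum = ((i : ℤ), (n : ℤ)) ↔
      ∑ l, (s.2 l).1 = i ∧ ∑ l, (s.2 l).2 = n := by
    rw [sum_steps, Prod.mk.injEq, Nat.cast_inj, Nat.cast_inj]
  have h4 : (steps s).Pairwise (fun p q => 0 < cr p q) ↔
      ∀ ⦃l l'⦄, l < l' → (s.2 l').1 * (s.2 l).2 < (s.2 l).1 * (s.2 l').2 := by
    rw [steps, List.pairwise_ofFn]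
    simp only [cr, sub_pos]
    norm_cast
  rw [h2, h3, h4, ← h1]
  simp only [indexSet, D, Set.mem_ofPred_eq]
  refine and_congr_right fun _ => ?_
  constructor
  · rintro ⟨hpos, ha, hb, hanti, hlt⟩
    refine ⟨fun l => ⟨(hpos l).1, ?_⟩, ⟨ha, hb⟩, fun l l' hl => ?_⟩
    · have := (hlt l).2
      rw [div_lt_one (by exact_mod_cast (hpos l).2)] at this
      exact_mod_cast this
    · have := hanti hl
      simp only at this
      rw [div_lt_div_iff₀ (by exact_mod_cast (hpos l').2) (by exact_mod_cast (hpos l).2)] at this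
      exact_mod_cast this
  · rintro ⟨hlt, ⟨ha, hb⟩, hcr⟩
    have hpos : ∀ l, 0 < (s.2 l).1 ∧ 0 < (s.2 l).2 := fun l => ⟨(hlt l).1, (hlt l).1.trans (hlt l).2⟩
    have hpos' : ∀ l, (0 : ℚ) < (s.2 l).1 ∧ (0 : ℚ) < (s.2 l).2 := fun l => by
      exact_mod_cast hpos l
    refine ⟨hpos, ha, hb, fun l l' hl => ?_, fun l => ⟨div_pos (hpos' l).1 (hpos' l).2, ?_⟩⟩
    · simp only
      rw [div_lt_div_iff₀ (hpos' l').2 (hpos' l).2]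
      exact_mod_cast hcr hl
    · rw [div_lt_one (hpos' l).2]
      exact_mod_cast (hlt l).2

theorem crossSum_ofFn {k : ℕ} (f : Fin k → ℤ × ℤ) :
    crossSum (List.ofFn f) = ∑ l, ∑ l' ∈ Finset.Ioi l, cr (f l) (f l') := by
  induction k with
  | zero => simp [crossSum]
  | succ k ih =>
    rw [List.ofFn_succ, crossSum, ih, Fin.sum_univ_succ, List.sum_ofFn, Fin.Ioi_zero_eq_map,
      Finset.sum_map]
    congr 1
    · simp only [cr, Prod.fst_sum, Prod.snd_sum, Finset.mul_sum, Finset.sum_mul,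
        Finset.sum_sub_distrib, Fin.coe_succEmb]
    · refine Finset.sum_congr rfl fun l _ => ?_
      rw [← Fin.map_succEmb_Ioi, Finset.sum_map]
      rfl

theorem exponent_eq (s : Σ k : ℕ, Fin k → ℕ × ℕ) :
    exponent s.2 = 1 - s.1 + ((crossSum (steps s) + gcdSum (steps s) : ℤ) : ℚ) / 2 := by
  rw [exponent, steps, crossSum_ofFn, gcdSum, List.map_ofFn, List.sum_ofFn]
  simp [cr]

/-- Only the exponential law is used, so a single argument covers formal powers and real powers. -/
theorem sum_indexSet {R : Type*} [CommRing R] (f : ℚ → R) (h0 : f 0 = 1)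
    (hadd : ∀ r r', f (r + r') = f r * f r') (i n j : ℕ) (hi : 0 < i) (hin : i < n)
    (hj : j = n - i) :
    ∑ s ∈ (indexSet_finite i n).toFinset, (f 1 - 1) ^ (s.1 - 1) * f (exponent s.2) =
      f (((i : ℚ) * j - n) / 2 + 1) := by
  classical
  have hpow : ∀ (r : ℚ) (m : ℕ), f r ^ m = f (m * r) := by
    intro r m
    induction m with
    | zero => simp [h0]
    | succ m ih =>
      rw [pow_succ, ih, ← hadd]
      congr 1
      push_cast
      ring
  have hq : f 1 - 1 = f 1 * (1 - f (-1)) := by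
    rw [mul_sub, ← hadd, add_neg_cancel, h0, mul_one]
  set e : ℤ × ℤ := ((i : ℤ), (n : ℤ)) with he
  have hen : e.1 < e.2 := by simpa [he] using hin
  have hmem : ∀ s, s ∈ (indexSet_finite i n).toFinset ↔ IsPath e (triangle e) 0 (steps s) := by
    intro s
    rw [Set.Finite.mem_toFinset, mem_indexSet_iff, IsPath.triangle_iff hen]
  have hS : ∀ L, L ∈ (indexSet_finite i n).toFinset.image steps ↔ IsPath e (triangle e) 0 L := by
    intro L
    rw [Finset.mem_image]
    constructor
    · rintro ⟨s, hs, rfl⟩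
      exact (hmem s).1 hs
    · intro h
      -- Passing to natural numbers loses nothing, since all steps have positive coordinates.
      have hL : steps ⟨_, (L.map fun p => (p.1.toNat, p.2.toNat)).get⟩ = L := by
        rw [steps_eq_map]
        simp only [List.ofFn_get, List.map_map]
        refine (List.map_congr_left fun p hp => ?_).trans (List.map_id L)
        have h1 := h.forall_pos p hp
        have h2 := h.forall_lt hen p hp
        ext <;> simp <;> omega
      exact ⟨_, (hmem _).2 (by rwa [hL]), hL⟩
  have hmain := sum_paths (f (-1)) e (triangle e) 0 (by simpa [he] using hi)
    (fun p hp => by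
      simp only [triangle, Finset.mem_filter, Finset.mem_product, Finset.mem_Ioo] at hp
      simpa using ⟨hp.1.1.1, hp.1.1.2, hp.2.2⟩) _ hS
  rw [Finset.sum_image steps_injective.injOn] at hmain
  refine Eq.trans ?_ ((congrArg (f (((i : ℚ) * j - n) / 2 + 1) * ·) hmain).trans (mul_one _))
  simp only [Finset.mul_sum]
  refine Finset.sum_congr rfl fun s hs => ?_
  have hp := (hmem s).1 hs
  have h1 := (IsPath.triangle_iff hen).1 hp
  -- From the origin this reads 2N = ij - n + 2 - C - G, which matches the exponents term by term.
  have hcard := two_mul_sum_card_above e (steps s) 0 h1.1 h1.2.1 le_rfl (by simpa using h1.2.2.1)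
  rw [Prod.fst_zero, Prod.snd_zero, ← hp.card_filter_above, h1.2.2.1] at hcard
  have hlen : (steps s).length = s.1 := by simp [steps]
  have hk : 1 ≤ s.1 := by rw [← hlen]; exact List.length_pos_iff.2 h1.1
  rw [hlen, hq, mul_pow, hpow 1, hpow (-1), mul_right_comm, ← hadd, mul_comm ((1 - f (-1)) ^ _),
    ← mul_assoc, ← hadd, exponent_eq]
  congr 2
  have hcard' := congrArg (Int.cast : ℤ → ℚ) hcard
  rw [hj]
  push_cast [he, Nat.cast_sub hk, Nat.cast_sub hin.le] at hcard' ⊢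
  linarith

end SlopeIdentity

theorem proposition1p1 (i n j : ℕ) (hi : 0 < i) (hin : i < n) (hj : j = n - i) :
    (∑ s ∈ (SlopeIdentity.indexSet_finite i n).toFinset,
        (SlopeIdentity.qPow 1 - 1) ^ (s.1 - 1) *
          SlopeIdentity.qPow (SlopeIdentity.exponent s.2)) =
      SlopeIdentity.qPow (((i : ℚ) * (j : ℚ) - (n : ℚ)) / 2 + 1) ∧
    ∀ q : ℝ, 0 < q →
      (∑ s ∈ (SlopeIdentity.indexSet_finite i n).toFinset,
          (q - 1) ^ (s.1 - 1) * q ^ ((SlopeIdentity.exponent s.2 : ℚ) : ℝ)) =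
        q ^ (((i : ℝ) * (j : ℝ) - (n : ℝ)) / 2 + 1) := by
  refine ⟨SlopeIdentity.sum_indexSet SlopeIdentity.qPow rfl
    (fun r r' => by simp [SlopeIdentity.qPow, AddMonoidAlgebra.single_mul_single]) i n j hi hin hj,
    fun q hq => ?_⟩
  have h := SlopeIdentity.sum_indexSet (fun r : ℚ => q ^ (r : ℝ)) (by simp)
    (fun r r' => by push_cast; exact Real.rpow_add hq _ _) i n j hi hin hj
  push_cast at h
  simpa only [Real.rpow_one] using h
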